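/- For $x\in[0,1)$ let $a'_1,a'_2,\dots$ be the digits of its negative continued fraction expansion $$x=1-\cfrac{1}{a'_1-\cfrac{1}{a'_2-\cfrac{1}{a'_3-\cdots}}},$$ that is, $a'_i=-\left\lfloor -1/T^{\,i-1}(1-x)\right\rfloor$ for $i\ge 1$, where $T(y)=-\frac1y-\left\lfloor-\frac1y\right\rfloor$ for $y\neq0$ and $T(0)=0$ (for irrational $x$ all iterates $T^{i-1}(1-x)$ are nonzero and all $a'_i$ are integers $\ge 2$). Let $p$ be a real number with $0<p<1$ and put $$M_{p,n}(x)=\left(\frac1n\sum_{k=1}^n (a'_k)^p\right)^{1/p}\qquad(n\ge1).$$ Then $\lim_{n\to\infty}M_{p,n}(x)=2$ for Lebesgue-almost every $x\in[0,1)$. -/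

import Mathlib

open MeasureTheory Filter Topology

noncomputable section

/-- The `N`-continued fraction map `T_N(x) = N/x - ⌊N/x⌋` for `x ≠ 0`, `T_N(0) = 0`. -/
def cfMap (N : ℤ) (x : ℝ) : ℝ :=
  if x = 0 then 0 else (N : ℝ) / x - (⌊(N : ℝ) / x⌋ : ℝ)

/-- The digits of the negative continued fraction expansion
`x = 1 - 1 / (a'₁ - 1 / (a'₂ - ⋯))`, numbered from `1`:
`a'ᵢ = -⌊-1 / T₋₁^(i-1)(1 - x)⌋` for `i ≥ 1`. -/
def negDigit (x : ℝ) (i : ℕ) : ℤ :=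
  -⌊(-1 : ℝ) / (cfMap (-1))^[i - 1] (1 - x)⌋

/-- The power mean `M_{p,n}(x)` of the first `n` negative continued fraction digits of `x`. -/
def negDigitPowerMean (p : ℝ) (n : ℕ) (x : ℝ) : ℝ :=
  ((∑ k ∈ Finset.Icc 1 n, (negDigit x k : ℝ) ^ p) / (n : ℝ)) ^ (1 / p)

end

/-! Let `x = [0; a₁, a₂, …]` be the regular continued fraction. The negative digits of `x` are `a₁ -
1` twos, then `a₂ + 2`, then `a₃ - 1` twos, then `a₄ + 2`, and so on. As `(b + 2)^p ≤ b^p + 2^p`,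
the first `n` digits exceed `n * 2^p` in `p`-th powers by at most `∑_{j ≤ k} a_{2j}^p` for some `k`
with `∑_{j ≤ k} a_{2j-1} ≤ n` (`exists_sum_negDigit_rpow_le`). Digits have infinite mean but finite
`p`-th moment for `p < 1`, so almost surely the first sum is negligible against the second
(`ae_eventually_sum_rpow_le`).

No ergodic theorem is used. The inequality `lintegral_gaussDigit_mul_le` bounds the law of a digit
uniformly in the digits that follow it. Peeling off two digits at a time bounds exponential moments
(`lintegral_exp_mul_comp_le`), and Borel–Cantelli concludes. -/

/-- The Gauss map `x ↦ 1/x mod 1`. -/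
noncomputable def gaussMap (x : ℝ) : ℝ := Int.fract x⁻¹

/-- The first regular continued fraction digit. -/
noncomputable def gaussDigit (x : ℝ) : ℕ := ⌊x⁻¹⌋₊

/-- The probability that the digit `a + 1` precedes the point `u`, for the Gauss measure. -/
noncomputable def gaussWeight (a : ℕ) (u : ℝ) : ℝ := (1 + u) / ((a + 1 + u) * (a + 2 + u))

/-- The (unnormalized) Gauss measure on `[0, 1)`. -/
noncomputable def gaussMeasure : Measure ℝ :=
  (volume.restrict (Set.Ico 0 1)).withDensity fun x => ENNReal.ofReal (1 + x)⁻¹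

/-! ### Inverse branches of the Gauss map and the transfer inequality. -/

lemma measurable_gaussMap : Measurable gaussMap := by unfold gaussMap; fun_prop

lemma measurable_gaussDigit : Measurable gaussDigit := by
  unfold gaussDigit; exact Nat.measurable_floor.comp measurable_inv

lemma gaussDigit_inv_add (a : ℕ) {u : ℝ} (hu : u ∈ Set.Ico (0 : ℝ) 1) :
    gaussDigit (a + 1 + u)⁻¹ = a + 1 := by
  rw [gaussDigit, inv_inv, Nat.floor_eq_iff (by linarith [hu.1, (Nat.cast_nonneg a : (0:ℝ) ≤ a)])]
  push_cast
  constructor <;> linarith [hu.1, hu.2]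

lemma gaussMap_inv_add (a : ℕ) {u : ℝ} (hu : u ∈ Set.Ico (0 : ℝ) 1) :
    gaussMap (a + 1 + u)⁻¹ = u := by
  rw [gaussMap, inv_inv, Int.fract_eq_iff]
  refine ⟨hu.1, hu.2, a + 1, ?_⟩
  push_cast; ring

lemma Ioo_subset_iUnion_image :
    Set.Ioo (0 : ℝ) 1 ⊆ ⋃ a : ℕ, (fun u : ℝ => ((a : ℝ) + 1 + u)⁻¹) '' Set.Ico 0 1 := by
  intro x hx
  have h1 : 1 < x⁻¹ := (one_lt_inv₀ hx.1).2 hx.2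
  have h2 : 1 ≤ ⌊x⁻¹⌋₊ := Nat.le_floor (by simpa using h1.le)
  refine Set.mem_iUnion.2 ⟨⌊x⁻¹⌋₊ - 1, x⁻¹ - ⌊x⁻¹⌋₊, ⟨?_, ?_⟩, ?_⟩
  · linarith [Nat.floor_le (zero_le_one.trans h1.le)]
  · linarith [Nat.lt_floor_add_one x⁻¹]
  · push_cast [h2]
    rw [show (⌊x⁻¹⌋₊ : ℝ) - 1 + 1 + (x⁻¹ - ⌊x⁻¹⌋₊) = x⁻¹ by ring, inv_inv]

lemma lintegral_gaussMeasure {F : ℝ → ENNReal} (hF : Measurable F) :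
    ∫⁻ x, F x ∂gaussMeasure = ∫⁻ x in Set.Ico (0 : ℝ) 1, ENNReal.ofReal (1 + x)⁻¹ * F x := by
  rw [gaussMeasure, lintegral_withDensity_eq_lintegral_mul _ (by fun_prop) hF]
  rfl

/-- Transfer inequality: conditioning the first digit on the tail of the expansion. -/
lemma lintegral_gaussDigit_mul_le (g : ℕ → ENNReal) {F : ℝ → ENNReal} (hF : Measurable F)
    {q : ENNReal}
    (hq : ∀ u ∈ Set.Ico (0 : ℝ) 1, ∑' a, g (a + 1) * ENNReal.ofReal (gaussWeight a u) ≤ q) :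
    ∫⁻ x, g (gaussDigit x) * F (gaussMap x) ∂gaussMeasure ≤ q * ∫⁻ x, F x ∂gaussMeasure := by
  have hg : Measurable fun x => g (gaussDigit x) := (measurable_of_countable g).comp measurable_gaussDigit
  have hFG : Measurable fun x => F (gaussMap x) := hF.comp measurable_gaussMap
  rw [lintegral_gaussMeasure (F := fun x => g (gaussDigit x) * F (gaussMap x)) (hg.mul hFG),
    lintegral_gaussMeasure hF,
    ← setLIntegral_congr (Ioo_ae_eq_Ico (a := (0 : ℝ)) (b := 1) (μ := volume)),
    ← lintegral_const_mul _ (by fun_prop)]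
  refine (lintegral_mono_set Ioo_subset_iUnion_image).trans ((lintegral_iUnion_le _ _).trans ?_)
  have key : ∀ a : ℕ, ∫⁻ x in (fun u : ℝ => ((a : ℝ) + 1 + u)⁻¹) '' Set.Ico 0 1,
        ENNReal.ofReal (1 + x)⁻¹ * (g (gaussDigit x) * F (gaussMap x))
      = ∫⁻ u in Set.Ico (0 : ℝ) 1, (g (a + 1) * ENNReal.ofReal (gaussWeight a u)) *
          (ENNReal.ofReal (1 + u)⁻¹ * F u) := by
    intro a
    have ha : (0 : ℝ) ≤ a := Nat.cast_nonneg a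
    rw [lintegral_image_eq_lintegral_abs_deriv_mul measurableSet_Ico
      (f' := fun u => -1 / ((a : ℝ) + 1 + u) ^ 2)]
    · refine setLIntegral_congr_fun measurableSet_Ico fun u hu => ?_
      have hu0 := hu.1
      -- With `s = a + 1 + u`, both sides equal `1 / (s * (s + 1))`: Jacobian times density at `1 /
      -- s` on the left.
      have e : ENNReal.ofReal |(-1 / ((a : ℝ) + 1 + u) ^ 2)| *
          ENNReal.ofReal (1 + ((a : ℝ) + 1 + u)⁻¹)⁻¹
          = ENNReal.ofReal (gaussWeight a u) * ENNReal.ofReal (1 + u)⁻¹ := by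
        rw [← ENNReal.ofReal_mul (abs_nonneg _), ← ENNReal.ofReal_mul (by unfold gaussWeight; positivity)]
        congr 1
        rw [neg_div, abs_neg, abs_of_nonneg (by positivity), gaussWeight]
        field_simp
        ring
      simp only [gaussDigit_inv_add a hu, gaussMap_inv_add a hu]
      rw [← mul_assoc, e]
      ring
    · intro u hu
      have : (a : ℝ) + 1 + u ≠ 0 := by linarith [hu.1]
      exact (((hasDerivAt_id u).const_add ((a : ℝ) + 1)).inv this).hasDerivWithinAt
    · intro u _ v _ h
      simpa using h
  simp_rw [key]
  have hw : ∀ a, Measurable (gaussWeight a) := fun a => by unfold gaussWeight; fun_prop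
  rw [← lintegral_tsum fun a => by have := hw a; fun_prop]
  refine setLIntegral_mono' measurableSet_Ico fun u hu => ?_
  rw [ENNReal.tsum_mul_right]
  gcongr
  exact hq u hu

lemma gaussMeasure_univ_le : gaussMeasure Set.univ ≤ 1 := by
  rw [← lintegral_one, lintegral_gaussMeasure measurable_const]
  calc _ ≤ ∫⁻ _ in Set.Ico (0 : ℝ) 1, (1 : ENNReal) := by
        refine setLIntegral_mono' measurableSet_Ico fun u hu => ?_
        rw [mul_one, ENNReal.ofReal_le_one]
        exact inv_le_one_of_one_le₀ (by linarith [hu.1])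
    _ = 1 := by simp

lemma absolutelyContinuous_gaussMeasure :
    volume.restrict (Set.Ico (0 : ℝ) 1) ≪ gaussMeasure := by
  refine withDensity_absolutelyContinuous' (by fun_prop) ?_
  filter_upwards [ae_restrict_mem measurableSet_Ico] with x hx
  have : 0 < (1 + x)⁻¹ := inv_pos.2 (by linarith [hx.1])
  simpa using this

/-! ### Moments of one digit given its successors. -/

lemma gaussWeight_nonneg (a : ℕ) {u : ℝ} (hu : 0 ≤ u) : 0 ≤ gaussWeight a u := by
  unfold gaussWeight; positivity

lemma gaussWeight_le (a : ℕ) {u : ℝ} (hu : u ∈ Set.Ico (0 : ℝ) 1) :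
    gaussWeight a u ≤ 2 / (a + 1 : ℝ) ^ 2 := by
  have h0 := hu.1
  have h1 := hu.2
  unfold gaussWeight
  rw [div_le_div_iff₀ (by positivity) (by positivity)]
  have : (0 : ℝ) ≤ a := Nat.cast_nonneg a
  nlinarith [mul_nonneg this h0, mul_nonneg this this, mul_nonneg (mul_nonneg this this) (sub_nonneg.2 h1.le)]

lemma le_gaussWeight (a : ℕ) {u : ℝ} (hu : u ∈ Set.Ico (0 : ℝ) 1) :
    1 / ((a + 2 : ℝ) * (a + 3)) ≤ gaussWeight a u := by
  have h0 := hu.1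
  have h1 := hu.2
  unfold gaussWeight
  have ha : (0 : ℝ) ≤ a := Nat.cast_nonneg a
  exact div_le_div₀ (by linarith) (by linarith) (by positivity)
    (mul_le_mul (by linarith) (by linarith) (by positivity) (by positivity))

/-- The series telescopes, since the weight is `(1 + u) * (1 / (a + 1 + u) - 1 / (a + 2 + u))`. -/
lemma hasSum_gaussWeight {u : ℝ} (hu : 0 ≤ u) : HasSum (fun a => gaussWeight a u) 1 := by
  rw [hasSum_iff_tendsto_nat_of_nonneg fun a => gaussWeight_nonneg a hu]
  have h : ∀ n : ℕ, ∑ a ∈ Finset.range n, gaussWeight a u = 1 - (1 + u) / (n + 1 + u) := by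
    intro n
    induction n with
    | zero => simp; rw [div_self (by positivity), sub_self]
    | succ n ih =>
      rw [Finset.sum_range_succ, ih, gaussWeight]
      push_cast
      field_simp
      ring
  simp_rw [h]
  have : Tendsto (fun n : ℕ => (1 + u) / ((n : ℝ) + 1 + u)) atTop (𝓝 0) := by
    refine Tendsto.div_atTop tendsto_const_nhds ?_
    exact tendsto_atTop_add_const_right _ _ (tendsto_atTop_add_const_right _ _ tendsto_natCast_atTop_atTop)
  simpa using this.const_sub 1

lemma tsum_ofReal_gaussWeight_le {g : ℕ → ℝ} (hg : ∀ a, 0 ≤ g a) {u q : ℝ} (hu : 0 ≤ u)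
    (hs : Summable fun a => g (a + 1) * gaussWeight a u)
    (hq : ∑' a, g (a + 1) * gaussWeight a u ≤ q) :
    ∑' a, ENNReal.ofReal (g (a + 1)) * ENNReal.ofReal (gaussWeight a u) ≤ ENNReal.ofReal q := by
  simp_rw [← ENNReal.ofReal_mul (hg _)]
  rw [← ENNReal.ofReal_tsum_of_nonneg (fun a => mul_nonneg (hg _) (gaussWeight_nonneg a hu)) hs]
  exact ENNReal.ofReal_le_ofReal hq

lemma summable_rpow_div_sq {t : ℝ} (ht : t < 1) :
    Summable fun a : ℕ => ((a + 1 : ℕ) : ℝ) ^ t * (2 / (a + 1 : ℝ) ^ 2) := by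
  have h := ((Real.summable_nat_rpow (p := t - 2)).2 (by linarith)).mul_left 2
  refine ((summable_nat_add_iff 1).2 h).congr fun a => ?_
  have : (0 : ℝ) < ((a + 1 : ℕ) : ℝ) := by positivity
  rw [Real.rpow_sub this, Real.rpow_two]
  push_cast; ring

/-- The `t`-th conditional moment of a digit is bounded by this constant. -/
noncomputable def momentBound (t : ℝ) : ℝ := ∑' a : ℕ, ((a + 1 : ℕ) : ℝ) ^ t * (2 / (a + 1 : ℝ) ^ 2)

lemma summable_rpow_mul_gaussWeight {t : ℝ} (ht : t < 1) {u : ℝ} (hu : u ∈ Set.Ico (0 : ℝ) 1) :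
    Summable fun a : ℕ => ((a + 1 : ℕ) : ℝ) ^ t * gaussWeight a u :=
  (summable_rpow_div_sq ht).of_nonneg_of_le
    (fun a => mul_nonneg (by positivity) (gaussWeight_nonneg a hu.1))
    fun a => mul_le_mul_of_nonneg_left (gaussWeight_le a hu) (by positivity)

lemma tsum_rpow_mul_gaussWeight_le {t : ℝ} (ht : t < 1) {u : ℝ} (hu : u ∈ Set.Ico (0 : ℝ) 1) :
    ∑' a : ℕ, ((a + 1 : ℕ) : ℝ) ^ t * gaussWeight a u ≤ momentBound t :=
  (summable_rpow_mul_gaussWeight ht hu).tsum_le_tsum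
    (fun a => mul_le_mul_of_nonneg_left (gaussWeight_le a hu) (by positivity))
    (summable_rpow_div_sq ht)

lemma exp_le_one_add_two_mul {t : ℝ} (h0 : 0 ≤ t) (h1 : t ≤ 1) : Real.exp t ≤ 1 + 2 * t := by
  have := Real.exp_bound' h0 h1 (n := 2) (by norm_num)
  simp [Finset.sum_range_succ] at this
  nlinarith

lemma exp_neg_le_one_sub_half {t : ℝ} (h0 : 0 ≤ t) (h1 : t ≤ 1) : Real.exp (-t) ≤ 1 - t / 2 := by
  have h : (0 : ℝ) < 1 + t := by linarith
  calc Real.exp (-t) = (Real.exp t)⁻¹ := Real.exp_neg t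
    _ ≤ (1 + t)⁻¹ := inv_anti₀ h (by linarith [Real.add_one_le_exp t])
    _ ≤ 1 - t / 2 := by
      rw [inv_le_iff_one_le_mul₀ h]
      nlinarith

/-- `x ^ p` truncated to zero once it exceeds `B`. -/
noncomputable def truncPow (p B : ℝ) (a : ℕ) : ℝ := if (a : ℝ) ^ p ≤ B then (a : ℝ) ^ p else 0

lemma truncPow_nonneg (p B : ℝ) (a : ℕ) : 0 ≤ truncPow p B a := by
  unfold truncPow; split_ifs <;> positivity

lemma truncPow_le_rpow (p B : ℝ) (a : ℕ) : truncPow p B a ≤ (a : ℝ) ^ p := by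
  unfold truncPow; split_ifs <;> first | exact le_rfl | positivity

lemma truncPow_le {B : ℝ} (hB : 0 ≤ B) (p : ℝ) (a : ℕ) : truncPow p B a ≤ B := by
  unfold truncPow; split_ifs <;> assumption

/-- Truncation keeps the exponent at most `1`, where `exp t ≤ 1 + 2 * t` reduces the exponential
moment to the `p`-th moment. -/
lemma tsum_exp_truncPow_le {p : ℝ} (hp : p < 1) {B θ : ℝ} (hB : 0 ≤ B) (hθ : 0 ≤ θ)
    (hθB : θ * B ≤ 1) {u : ℝ} (hu : u ∈ Set.Ico (0 : ℝ) 1) :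
    ∑' a, ENNReal.ofReal (Real.exp (θ * truncPow p B (a + 1))) * ENNReal.ofReal (gaussWeight a u)
      ≤ ENNReal.ofReal (Real.exp (θ * (2 * momentBound p))) := by
  have hw := hasSum_gaussWeight hu.1
  have hs := (hw.add ((summable_rpow_mul_gaussWeight hp hu).hasSum.mul_left (2 * θ)))
  have hle : ∀ a : ℕ, Real.exp (θ * truncPow p B (a + 1)) * gaussWeight a u
      ≤ gaussWeight a u + 2 * θ * (((a + 1 : ℕ) : ℝ) ^ p * gaussWeight a u) := by
    intro a
    have h1 := exp_le_one_add_two_mul (mul_nonneg hθ (truncPow_nonneg p B (a + 1)))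
      ((mul_le_mul_of_nonneg_left (truncPow_le hB p (a + 1)) hθ).trans hθB)
    have h2 := mul_le_mul_of_nonneg_left (truncPow_le_rpow p B (a + 1)) hθ
    calc _ ≤ (1 + 2 * (θ * ((a + 1 : ℕ) : ℝ) ^ p)) * gaussWeight a u :=
          mul_le_mul_of_nonneg_right (by linarith) (gaussWeight_nonneg a hu.1)
      _ = _ := by ring
  have hs' : Summable fun a : ℕ => Real.exp (θ * truncPow p B (a + 1)) * gaussWeight a u :=
    hs.summable.of_nonneg_of_le
      (fun a => mul_nonneg (Real.exp_pos _).le (gaussWeight_nonneg a hu.1)) hle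
  refine tsum_ofReal_gaussWeight_le (g := fun a => Real.exp (θ * truncPow p B a))
    (fun a => (Real.exp_pos _).le) hu.1 hs' ?_
  refine (hs'.tsum_le_tsum hle hs.summable).trans ?_
  rw [hs.tsum_eq]
  have := mul_le_mul_of_nonneg_left (tsum_rpow_mul_gaussWeight_le hp hu) hθ
  linarith [Real.add_one_le_exp (θ * (2 * momentBound p))]

lemma tendsto_sum_harmonic :
    Tendsto (fun L : ℕ => ∑ a ∈ Finset.range L, ((a + 1 : ℕ) : ℝ) * (1 / ((a + 2 : ℝ) * (a + 3))))
      atTop atTop := by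
  have h := Real.tendsto_sum_range_one_div_nat_succ_atTop.const_mul_atTop (r := 1 / 6) (by norm_num)
  refine tendsto_atTop_mono (fun L => ?_) h
  rw [Finset.mul_sum]
  refine Finset.sum_le_sum fun a _ => ?_
  have : (0 : ℝ) ≤ a := Nat.cast_nonneg a
  push_cast
  rw [div_mul_div_comm, mul_one_div, div_le_div_iff₀ (by positivity) (by positivity)]
  nlinarith [mul_nonneg this this]

/-- Digits have infinite mean: `E exp (-s a) ≤ 1 - D s` for every `D` once `s` is small. -/
lemma exists_tsum_exp_neg_le (D : ℝ) : ∃ s₀ > 0, ∀ s, 0 ≤ s → s ≤ s₀ →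
    ∀ u ∈ Set.Ico (0 : ℝ) 1,
    ∑' a, ENNReal.ofReal (Real.exp (-(s * ((a + 1 : ℕ) : ℝ)))) * ENNReal.ofReal (gaussWeight a u)
      ≤ ENNReal.ofReal (Real.exp (-(s * D))) := by
  -- The factor `2` pays for the loss in `exp (-t) ≤ 1 - t / 2`, which is applied only to the first
  -- `L` digit values.
  obtain ⟨L, hL⟩ := (tendsto_sum_harmonic.eventually_ge_atTop (2 * D)).exists
  refine ⟨1 / (L + 1), by positivity, fun s hs0 hs u hu => ?_⟩
  have hw := hasSum_gaussWeight hu.1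
  have hw0 := fun a => gaussWeight_nonneg a hu.1
  have hsL : s * (L + 1) ≤ 1 := by rwa [le_div_iff₀ (by positivity)] at hs
  set c : ℕ → ℝ := fun a => if a ∈ Finset.range L then s / 2 * (((a + 1 : ℕ) : ℝ) * gaussWeight a u) else 0
  have hc : HasSum c (∑ a ∈ Finset.range L, c a) :=
    hasSum_sum_of_ne_finset_zero fun a ha => if_neg ha
  have hle : ∀ a : ℕ, Real.exp (-(s * ((a + 1 : ℕ) : ℝ))) * gaussWeight a u ≤ gaussWeight a u - c a := by
    intro a
    by_cases ha : a ∈ Finset.range L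
    · have h1 : s * ((a + 1 : ℕ) : ℝ) ≤ 1 := by
        refine le_trans (mul_le_mul_of_nonneg_left ?_ hs0) hsL
        have := Finset.mem_range.1 ha
        exact_mod_cast (by omega : a + 1 ≤ L + 1)
      simp only [c, if_pos ha]
      have := mul_le_mul_of_nonneg_right (exp_neg_le_one_sub_half (by positivity) h1) (hw0 a)
      linarith
    · simp only [c, if_neg ha, sub_zero]
      exact mul_le_of_le_one_left (hw0 a) (Real.exp_le_one_iff.2 (neg_nonpos.2 (by positivity)))
  have hs' : Summable fun a : ℕ => Real.exp (-(s * ((a + 1 : ℕ) : ℝ))) * gaussWeight a u :=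
    (hw.sub hc).summable.of_nonneg_of_le (fun a => mul_nonneg (Real.exp_pos _).le (hw0 a)) hle
  refine tsum_ofReal_gaussWeight_le (g := fun a => Real.exp (-(s * (a : ℝ))))
    (fun a => (Real.exp_pos _).le) hu.1 hs' ?_
  refine (hs'.tsum_le_tsum hle (hw.sub hc).summable).trans ?_
  rw [(hw.sub hc).tsum_eq]
  have hsum : s * D ≤ ∑ a ∈ Finset.range L, c a := by
    calc s * D ≤ s / 2 * ∑ a ∈ Finset.range L, ((a + 1 : ℕ) : ℝ) * (1 / ((a + 2 : ℝ) * (a + 3))) := by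
          nlinarith
      _ ≤ _ := by
        rw [Finset.mul_sum]
        refine Finset.sum_le_sum fun a ha => ?_
        simp only [c, if_pos ha]
        have := le_gaussWeight a hu
        gcongr
  linarith [Real.add_one_le_exp (-(s * D))]

/-- With `M = momentBound p`, the infinite mean of the first digit yields a factor `exp (-θ * (2 * M
+ 1))`, which outweighs the factor `exp (2 * θ * M)` from the second. -/
lemma lintegral_exp_mul_comp_le {p ε : ℝ} (hp : p < 1) (hε : 0 < ε) :
    ∃ θ₀ > 0, ∀ θ B : ℝ, 0 ≤ θ → θ ≤ θ₀ → 0 ≤ B → θ * B ≤ 1 →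
    ∀ F : ℝ → ENNReal, Measurable F →
    ∫⁻ x, ENNReal.ofReal (Real.exp (θ * (truncPow p B (gaussDigit (gaussMap x)) - ε * gaussDigit x))) *
      F (gaussMap (gaussMap x)) ∂gaussMeasure ≤
    ENNReal.ofReal (Real.exp (-θ)) * ∫⁻ x, F x ∂gaussMeasure := by
  obtain ⟨s₀, hs₀, h⟩ := exists_tsum_exp_neg_le ((2 * momentBound p + 1) / ε)
  refine ⟨s₀ / ε, by positivity, fun θ B hθ hθ₀ hB hθB F hF => ?_⟩
  rw [le_div_iff₀ hε] at hθ₀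
  have hF' : Measurable fun y => ENNReal.ofReal (Real.exp (θ * truncPow p B (gaussDigit y))) *
      F (gaussMap y) :=
    ((measurable_of_countable fun n => ENNReal.ofReal (Real.exp (θ * truncPow p B n))).comp
      measurable_gaussDigit).mul (hF.comp measurable_gaussMap)
  have h1 := lintegral_gaussDigit_mul_le
    (fun n => ENNReal.ofReal (Real.exp (-(θ * ε * (n : ℝ))))) hF'
    (h (θ * ε) (by positivity) hθ₀)
  have h2 := lintegral_gaussDigit_mul_le
    (fun n => ENNReal.ofReal (Real.exp (θ * truncPow p B n))) hF
    (fun u hu => tsum_exp_truncPow_le hp hB hθ hθB hu)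
  calc _ = ∫⁻ x, ENNReal.ofReal (Real.exp (-(θ * ε * (gaussDigit x : ℝ)))) *
        (ENNReal.ofReal (Real.exp (θ * truncPow p B (gaussDigit (gaussMap x)))) *
          F (gaussMap (gaussMap x))) ∂gaussMeasure := by
        refine lintegral_congr fun x => ?_
        rw [← mul_assoc, ← ENNReal.ofReal_mul (Real.exp_pos _).le, ← Real.exp_add]
        congr 3
        ring
    _ ≤ _ := h1
    _ ≤ _ := mul_le_mul_right h2 _
    _ = _ := by
        rw [← mul_assoc, ← ENNReal.ofReal_mul (Real.exp_pos _).le, ← Real.exp_add]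
        congr 3
        field_simp
        ring

/-! ### Almost sure comparison of even and odd digits. -/

/-- The square of the Gauss map, removing two digits at a time. -/
noncomputable def gaussMapSq (x : ℝ) : ℝ := gaussMap (gaussMap x)

lemma measurable_gaussMapSq : Measurable gaussMapSq := measurable_gaussMap.comp measurable_gaussMap

lemma measurable_birkhoffSum_gaussMapSq {φ : ℝ → ℝ} (hφ : Measurable φ) (k : ℕ) :
    Measurable (birkhoffSum gaussMapSq φ k) := by
  unfold birkhoffSum
  exact Finset.measurable_sum _ fun j _ => hφ.comp (measurable_gaussMapSq.iterate j)

/-- The excess of the truncated second digit over `ε` times the first digit. -/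
noncomputable def digitExcess (p ε B : ℝ) (x : ℝ) : ℝ :=
  truncPow p B (gaussDigit (gaussMap x)) - ε * gaussDigit x

lemma measurable_digitExcess (p ε B : ℝ) : Measurable (digitExcess p ε B) := by
  have h1 : Measurable fun x => truncPow p B (gaussDigit (gaussMap x)) :=
    (measurable_of_countable (truncPow p B)).comp (measurable_gaussDigit.comp measurable_gaussMap)
  have h2 : Measurable fun x => ε * (gaussDigit x : ℝ) :=
    (measurable_of_countable fun n : ℕ => ε * (n : ℝ)).comp measurable_gaussDigit
  exact h1.sub h2

lemma lintegral_exp_birkhoffSum_le {p ε : ℝ} (hp : p < 1) (hε : 0 < ε) :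
    ∃ θ₀ > 0, ∀ θ B : ℝ, 0 ≤ θ → θ ≤ θ₀ → 0 ≤ B → θ * B ≤ 1 → ∀ k : ℕ,
    ∫⁻ x, ENNReal.ofReal (Real.exp (θ * birkhoffSum gaussMapSq (digitExcess p ε B) k x)) ∂gaussMeasure
      ≤ ENNReal.ofReal (Real.exp (-θ)) ^ k := by
  obtain ⟨θ₀, hθ₀, h⟩ := lintegral_exp_mul_comp_le hp hε
  refine ⟨θ₀, hθ₀, fun θ B h1 h2 h3 h4 k => ?_⟩
  induction k with
  | zero => simpa using gaussMeasure_univ_le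
  | succ k ih =>
    have hm := measurable_birkhoffSum_gaussMapSq (measurable_digitExcess p ε B) k
    have := h θ B h1 h2 h3 h4
      (fun x => ENNReal.ofReal (Real.exp (θ * birkhoffSum gaussMapSq (digitExcess p ε B) k x)))
      (by fun_prop)
    rw [pow_succ']
    refine le_trans (le_of_eq ?_) (this.trans (mul_le_mul_right ih _))
    refine lintegral_congr fun x => ?_
    rw [birkhoffSum_succ', ← ENNReal.ofReal_mul (Real.exp_pos _).le, ← Real.exp_add, mul_add]
    rfl

lemma summable_exp_neg_rpow {r : ℝ} (hr : 0 < r) :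
    Summable fun k : ℕ => Real.exp (-(k : ℝ) ^ r) := by
  have h := (isLittleO_exp_neg_mul_rpow_atTop one_pos (-2 / r)).isBigO.comp_tendsto
    ((tendsto_rpow_atTop hr).comp tendsto_natCast_atTop_atTop)
  refine summable_of_isBigO_nat ((Real.summable_nat_rpow (p := -2)).2 (by norm_num)) ?_
  refine (h.congr_left fun k => ?_).congr_right fun k => ?_
  · simp
  · simp only [Function.comp]
    rw [← Real.rpow_mul (Nat.cast_nonneg k)]
    congr 1
    field_simp

/-- A Chernoff bound with `B = k^q` and `θ = k^(-q)`, so that `θ * B = 1`, gives probability at most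
`exp (-k^(1 - q))`. This is summable because `q < 1`, so Borel–Cantelli applies. -/
lemma ae_eventually_birkhoffSum_le {p ε q : ℝ} (hp : p < 1) (hε : 0 < ε) (hq0 : 0 < q) (hq1 : q < 1) :
    ∀ᵐ x ∂gaussMeasure, ∀ᶠ k : ℕ in atTop,
      birkhoffSum gaussMapSq (digitExcess p ε ((k : ℝ) ^ q)) k x ≤ 0 := by
  obtain ⟨θ₀, hθ₀, h⟩ := lintegral_exp_birkhoffSum_le hp hε
  have hev : ∀ᶠ k : ℕ in atTop, ((k : ℝ) ^ q)⁻¹ ≤ θ₀ ∧ 1 ≤ k := by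
    have h1 := (tendsto_inv_atTop_zero.comp
      ((tendsto_rpow_atTop hq0).comp tendsto_natCast_atTop_atTop)).eventually_le_const hθ₀
    exact h1.and (eventually_ge_atTop 1)
  obtain ⟨K, hK⟩ := eventually_atTop.1 hev
  have hm : ∀ k ≥ K, gaussMeasure {x | 0 < birkhoffSum gaussMapSq (digitExcess p ε ((k : ℝ) ^ q)) k x}
      ≤ ENNReal.ofReal (Real.exp (-(k : ℝ) ^ (1 - q))) := by
    intro k hk
    obtain ⟨h1, h2⟩ := hK k hk
    have hk0 : (0 : ℝ) < k := by exact_mod_cast h2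
    have hkq : 0 < (k : ℝ) ^ q := by positivity
    have hb := h ((k : ℝ) ^ q)⁻¹ ((k : ℝ) ^ q) (by positivity) h1 hkq.le
      (inv_mul_cancel₀ hkq.ne').le k
    rw [← ENNReal.ofReal_pow (Real.exp_pos _).le, ← Real.exp_nat_mul] at hb
    have e : (k : ℝ) * -((k : ℝ) ^ q)⁻¹ = -(k : ℝ) ^ (1 - q) := by
      rw [Real.rpow_sub hk0, Real.rpow_one]; ring
    rw [e] at hb
    refine le_trans ?_ hb
    have hms := measurable_birkhoffSum_gaussMapSq (measurable_digitExcess p ε ((k : ℝ) ^ q)) k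
    refine le_trans ?_ (mul_meas_ge_le_lintegral (by fun_prop) 1)
    rw [one_mul]
    refine measure_mono fun x hx => ?_
    rw [Set.mem_ofPred_eq] at hx ⊢
    rw [ENNReal.one_le_ofReal]
    exact Real.one_le_exp (by positivity)
  have hsum : ∑' k, gaussMeasure
      {x | 0 < birkhoffSum gaussMapSq (digitExcess p ε (((k + K : ℕ) : ℝ) ^ q)) (k + K) x} ≠ ⊤ := by
    have hs := (summable_nat_add_iff K).2 (summable_exp_neg_rpow (sub_pos.2 hq1))
    refine ne_top_of_le_ne_top hs.tsum_ofReal_ne_top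
      (ENNReal.tsum_le_tsum fun k => hm _ (Nat.le_add_left _ _))
  filter_upwards [ae_eventually_notMem hsum] with x hx
  obtain ⟨N, hN⟩ := eventually_atTop.1 hx
  refine eventually_atTop.2 ⟨N + K, fun k hk => ?_⟩
  have := hN (k - K) (by omega)
  rw [Nat.sub_add_cancel (by omega : K ≤ k)] at this
  exact not_lt.1 this

/-- The transfer inequality with `g = 1`: the weights sum to `1`. This half of the invariance of
Gauss measure suffices. -/
lemma lintegral_comp_gaussMap_le {F : ℝ → ENNReal} (hF : Measurable F) :
    ∫⁻ x, F (gaussMap x) ∂gaussMeasure ≤ ∫⁻ x, F x ∂gaussMeasure := by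
  have := lintegral_gaussDigit_mul_le (fun _ => 1) hF (q := 1) fun u hu => by
    have := tsum_ofReal_gaussWeight_le (g := fun _ => 1) (fun _ => zero_le_one) hu.1
      (by simpa using (hasSum_gaussWeight hu.1).summable)
      (by simpa using (hasSum_gaussWeight hu.1).tsum_eq.le)
    simpa using this
  simpa using this

lemma lintegral_comp_gaussMapSq_iterate_le (j : ℕ) : ∀ {F : ℝ → ENNReal}, Measurable F →
    ∫⁻ x, F (gaussMapSq^[j] x) ∂gaussMeasure ≤ ∫⁻ x, F x ∂gaussMeasure := by
  induction j with
  | zero => intro F _; simp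
  | succ j ih =>
    intro F hF
    simp_rw [Function.iterate_succ_apply']
    exact (ih (hF.comp measurable_gaussMapSq)).trans
      ((lintegral_comp_gaussMap_le (hF.comp measurable_gaussMap)).trans (lintegral_comp_gaussMap_le hF))

lemma lintegral_gaussDigit_rpow_le {t : ℝ} (ht : t < 1) :
    ∫⁻ x, ENNReal.ofReal ((gaussDigit x : ℝ) ^ t) ∂gaussMeasure ≤ ENNReal.ofReal (momentBound t) := by
  have := lintegral_gaussDigit_mul_le (fun n => ENNReal.ofReal ((n : ℝ) ^ t))
    (F := fun _ => 1) measurable_const fun u hu =>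
      tsum_ofReal_gaussWeight_le (g := fun n => (n : ℝ) ^ t) (fun n => by positivity) hu.1
        (summable_rpow_mul_gaussWeight ht hu) (tsum_rpow_mul_gaussWeight_le ht hu)
  simp only [mul_one, lintegral_one] at this
  exact this.trans (mul_le_of_le_one_right' gaussMeasure_univ_le)

/-- Shows that truncation at level `k^q` is eventually harmless. Markov's inequality for the `t`-th
moment gives `O(j^(-q * t / p))`, summable once `p / q < t < 1`. -/
lemma ae_eventually_gaussDigit_rpow_le {p q : ℝ} (hp : 0 < p) (hpq : p < q) :
    ∀ᵐ x ∂gaussMeasure, ∀ᶠ j : ℕ in atTop,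
      (gaussDigit (gaussMap (gaussMapSq^[j] x)) : ℝ) ^ p ≤ (j : ℝ) ^ q := by
  have hq : 0 < q := hp.trans hpq
  obtain ⟨t, ht0, ht1⟩ := exists_between ((div_lt_one hq).2 hpq)
  have ht : 0 < t := (div_pos hp hq).trans ht0
  have hr : 1 < q * t / p := by
    rw [div_lt_iff₀ hq] at ht0
    rw [lt_div_iff₀ hp]; linarith
  have hm : ∀ j : ℕ, gaussMeasure
      {x | ((j + 1 : ℕ) : ℝ) ^ q < (gaussDigit (gaussMap (gaussMapSq^[j + 1] x)) : ℝ) ^ p}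
      ≤ ENNReal.ofReal (momentBound t * ((j + 1 : ℕ) : ℝ) ^ (-(q * t / p))) := by
    intro j
    have hj : (0 : ℝ) < ((j + 1 : ℕ) : ℝ) := by positivity
    have hd : Measurable fun x => ENNReal.ofReal ((gaussDigit x : ℝ) ^ t) :=
      (measurable_of_countable fun n : ℕ => ENNReal.ofReal ((n : ℝ) ^ t)).comp measurable_gaussDigit
    have hb := (lintegral_comp_gaussMapSq_iterate_le (j + 1) (hd.comp measurable_gaussMap)).trans
      ((lintegral_comp_gaussMap_le hd).trans (lintegral_gaussDigit_rpow_le ht1))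
    have hd' := (hd.comp measurable_gaussMap).comp (measurable_gaussMapSq.iterate (j + 1))
    have hM := mul_meas_ge_le_lintegral (μ := gaussMeasure) hd'
      (ENNReal.ofReal (((j + 1 : ℕ) : ℝ) ^ (q * t / p)))
    rw [Real.rpow_neg hj.le, ← div_eq_mul_inv, ENNReal.ofReal_div_of_pos (by positivity),
      ENNReal.le_div_iff_mul_le (by left; simp; positivity) (by left; simp), mul_comm]
    refine le_trans (mul_le_mul_right (measure_mono fun x hx => ?_) _) (hM.trans hb)
    rw [Set.mem_ofPred_eq] at hx ⊢
    refine ENNReal.ofReal_le_ofReal ?_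
    have := Real.rpow_le_rpow (by positivity) hx.le (by positivity : 0 ≤ t / p)
    rw [← Real.rpow_mul hj.le, ← Real.rpow_mul (Nat.cast_nonneg _)] at this
    convert this using 2 <;> field_simp
  have hsum : ∑' j : ℕ, gaussMeasure
      {x | ((j + 1 : ℕ) : ℝ) ^ q < (gaussDigit (gaussMap (gaussMapSq^[j + 1] x)) : ℝ) ^ p} ≠ ⊤ := by
    have hs := ((summable_nat_add_iff 1).2
      ((Real.summable_nat_rpow (p := -(q * t / p))).2 (by linarith))).mul_left (momentBound t)
    exact ne_top_of_le_ne_top hs.tsum_ofReal_ne_top (ENNReal.tsum_le_tsum hm)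
  filter_upwards [ae_eventually_notMem hsum] with x hx
  obtain ⟨N, hN⟩ := eventually_atTop.1 hx
  refine eventually_atTop.2 ⟨N + 1, fun j hj => ?_⟩
  have := hN (j - 1) (by omega)
  rw [Nat.sub_add_cancel (by omega : 1 ≤ j)] at this
  exact not_lt.1 this

/-- For almost every `x`, the sum of the `p`-th powers of the digits in even positions is
negligible compared to the sum of the digits in odd positions. -/
lemma ae_eventually_sum_rpow_le {p ε : ℝ} (hp0 : 0 < p) (hp1 : p < 1) (hε : 0 < ε) :
    ∀ᵐ x ∂gaussMeasure, ∀ᶠ k : ℕ in atTop,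
      birkhoffSum gaussMapSq (fun y => (gaussDigit (gaussMap y) : ℝ) ^ p) k x ≤
        ε * birkhoffSum gaussMapSq (fun y => (gaussDigit y : ℝ)) k x := by
  obtain ⟨q, hpq, hq1⟩ := exists_between hp1
  have hq0 := hp0.trans hpq
  filter_upwards [ae_eventually_birkhoffSum_le hp1 hε hq0 hq1,
    ae_eventually_gaussDigit_rpow_le hp0 hpq] with x h1 h2
  obtain ⟨J, hJ⟩ := eventually_atTop.1 h2
  -- The finitely many digits not controlled by `hJ` fall below `k^q` once `k` is large.
  have h3 : ∀ᶠ k : ℕ in atTop, ∀ j ∈ Finset.range J,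
      (gaussDigit (gaussMap (gaussMapSq^[j] x)) : ℝ) ^ p ≤ (k : ℝ) ^ q :=
    (Finset.eventually_all _).2 fun j _ =>
      ((tendsto_rpow_atTop hq0).comp tendsto_natCast_atTop_atTop).eventually_ge_atTop _
  filter_upwards [h1, h3] with k hk hk'
  have e : birkhoffSum gaussMapSq (digitExcess p ε ((k : ℝ) ^ q)) k x =
      birkhoffSum gaussMapSq (fun y => (gaussDigit (gaussMap y) : ℝ) ^ p) k x -
        ε * birkhoffSum gaussMapSq (fun y => (gaussDigit y : ℝ)) k x := by
    simp only [birkhoffSum]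
    rw [Finset.mul_sum, ← Finset.sum_sub_distrib]
    refine Finset.sum_congr rfl fun j hj => ?_
    have hjk : (gaussDigit (gaussMap (gaussMapSq^[j] x)) : ℝ) ^ p ≤ (k : ℝ) ^ q := by
      by_cases hjJ : j < J
      · exact hk' j (Finset.mem_range.2 hjJ)
      · refine (hJ j (not_lt.1 hjJ)).trans (Real.rpow_le_rpow (Nat.cast_nonneg _) ?_ hq0.le)
        exact_mod_cast (Finset.mem_range.1 hj).le
    rw [digitExcess, truncPow, if_pos hjk]
  linarith

/-! ### Negative digits in terms of regular digits. -/

lemma cfMap_neg_one_one_sub_of_lt_half {x : ℝ} (h0 : 0 < x) (h1 : x < 1 / 2) :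
    negDigit x 1 = 2 ∧ cfMap (-1) (1 - x) = 1 - x / (1 - x) := by
  have hx : 0 < 1 - x := by linarith
  have hf : ⌊(-1 : ℝ) / (1 - x)⌋ = -2 := by
    rw [Int.floor_eq_iff, le_div_iff₀ hx, div_lt_iff₀ hx]
    push_cast
    constructor <;> linarith
  refine ⟨by simp [negDigit, hf], ?_⟩
  rw [cfMap, if_neg hx.ne']
  push_cast
  rw [hf]
  push_cast
  field_simp
  ring

/-- The map `x ↦ x / (1 - x)` lowers `1 / x` by one, so each negative digit `2` uses up one unit of
the first regular digit. -/
lemma gaussDigit_gaussMap_of_lt_half {x : ℝ} (h0 : 0 < x) (h1 : x < 1 / 2) :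
    gaussDigit x = gaussDigit (x / (1 - x)) + 1 ∧ gaussMap (x / (1 - x)) = gaussMap x := by
  have hx : 0 < 1 - x := by linarith
  have e : x⁻¹ = (x / (1 - x))⁻¹ + 1 := by field_simp; ring
  constructor
  · rw [gaussDigit, e, Nat.floor_add_one (by positivity), gaussDigit]
  · rw [gaussMap, gaussMap, e, Int.fract_add_one]

lemma Irrational.gaussMap_mem_Ioo {x : ℝ} (hx : Irrational x) :
    Irrational (gaussMap x) ∧ gaussMap x ∈ Set.Ioo (0 : ℝ) 1 := by
  have h : Irrational (gaussMap x) := hx.inv.sub_intCast _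
  exact ⟨h, lt_of_le_of_ne (Int.fract_nonneg _) h.ne_zero.symm, Int.fract_lt_one _⟩

lemma gaussDigit_add_gaussMap {x : ℝ} (hx : 0 < x) : (gaussDigit x : ℝ) + gaussMap x = x⁻¹ := by
  rw [gaussDigit, gaussMap, natCast_floor_eq_intCast_floor (inv_pos.2 hx).le, Int.floor_add_fract]

/-- The end of a block: one negative step consumes two regular digits, `1` and `b`, and outputs `b +
2`. -/
lemma cfMap_neg_one_one_sub_of_half_lt {x : ℝ} (hx : Irrational x) (h0 : 1 / 2 < x) (h1 : x < 1) :
    gaussDigit x = 1 ∧ negDigit x 1 = gaussDigit (gaussMap x) + 2 ∧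
      cfMap (-1) (1 - x) = 1 - gaussMapSq x := by
  have hx0 : 0 < x := by linarith
  have hx1 : 0 < 1 - x := by linarith
  have hd : gaussDigit x = 1 := by
    rw [gaussDigit, Nat.floor_eq_iff (inv_pos.2 hx0).le]
    push_cast
    constructor
    · exact (one_lt_inv₀ hx0).2 h1 |>.le
    · rw [inv_lt_comm₀ hx0 (by norm_num)]; norm_num; linarith
  have hu := gaussDigit_add_gaussMap hx0
  obtain ⟨hi, hu0, -⟩ := hx.gaussMap_mem_Ioo
  have hv := gaussDigit_add_gaussMap hu0
  obtain ⟨-, hv0, hv1⟩ := hi.gaussMap_mem_Ioo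
  have e : (-1 : ℝ) / (1 - x) = -(gaussDigit (gaussMap x) + gaussMap (gaussMap x) + 1) := by
    rw [hv, show gaussMap x = (1 - x) / x by rw [hd] at hu; field_simp at hu ⊢; push_cast at hu; linarith]
    field_simp
    ring
  have hf : ⌊(-1 : ℝ) / (1 - x)⌋ = -(gaussDigit (gaussMap x) + 2) := by
    rw [e, Int.floor_eq_iff]
    push_cast
    constructor <;> linarith
  refine ⟨hd, by simp [negDigit, hf], ?_⟩
  rw [cfMap, if_neg hx1.ne']
  push_cast
  rw [hf, e, gaussMapSq]
  push_cast
  ring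

lemma negDigit_succ_of_cfMap_eq {x y : ℝ} (h : cfMap (-1) (1 - x) = 1 - y) (i : ℕ) :
    negDigit x (i + 1 + 1) = negDigit y (i + 1) := by
  simp only [negDigit, Nat.add_sub_cancel, Function.iterate_succ_apply, h]

lemma irrational_div_one_sub {x : ℝ} (hx : Irrational x) (h0 : 0 < x) (h1 : x < 1 / 2) :
    Irrational (x / (1 - x)) ∧ x / (1 - x) ∈ Set.Ioo (0 : ℝ) 1 := by
  have hx1 : 0 < 1 - x := by linarith
  refine ⟨?_, by positivity, by rw [div_lt_one hx1]; linarith⟩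
  have e : x / (1 - x) = (x⁻¹ - (1 : ℤ))⁻¹ := by
    rw [Int.cast_one, show x⁻¹ - 1 = (1 - x) / x by field_simp, inv_div]
  rw [e]
  exact (hx.inv.sub_intCast 1).inv

lemma two_le_negDigit (i : ℕ) : ∀ {x : ℝ}, Irrational x → x ∈ Set.Ioo (0 : ℝ) 1 →
    2 ≤ negDigit x (i + 1) := by
  have hstep : ∀ {x : ℝ}, Irrational x → x ∈ Set.Ioo (0 : ℝ) 1 → 2 ≤ negDigit x 1 ∧
      ∃ y, Irrational y ∧ y ∈ Set.Ioo (0 : ℝ) 1 ∧ cfMap (-1) (1 - x) = 1 - y := by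
    intro x hx h
    have hhalf : x ≠ 1 / 2 := by simpa using hx.ne_rat (1 / 2)
    rcases lt_or_gt_of_ne hhalf with h2 | h2
    · obtain ⟨hd, hT⟩ := cfMap_neg_one_one_sub_of_lt_half h.1 h2
      obtain ⟨hy, hy'⟩ := irrational_div_one_sub hx h.1 h2
      exact ⟨hd.ge, _, hy, hy', hT⟩
    · obtain ⟨-, hd, hT⟩ := cfMap_neg_one_one_sub_of_half_lt hx h2 h.2
      obtain ⟨hy, hy'⟩ := hx.gaussMap_mem_Ioo.1.gaussMap_mem_Ioo
      exact ⟨by omega, _, hy, hy', hT⟩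
  induction i with
  | zero => exact fun hx h => (hstep hx h).1
  | succ i ih =>
    intro x hx h
    obtain ⟨-, y, hy, hy', e⟩ := hstep hx h
    rw [negDigit_succ_of_cfMap_eq e]
    exact ih hy hy'

/-- The first `n` negative digits consist of complete blocks `2, …, 2, b + 2`, followed by an
incomplete block of digits `2`. -/
lemma exists_sum_negDigit_rpow_le {p : ℝ} (hp0 : 0 < p) (hp1 : p < 1) (n : ℕ) :
    ∀ {x : ℝ}, Irrational x → x ∈ Set.Ioo (0 : ℝ) 1 → ∃ k : ℕ,
      ∑ i ∈ Finset.range n, ((negDigit x (i + 1) : ℝ) ^ p - 2 ^ p) ≤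
        birkhoffSum gaussMapSq (fun y => (gaussDigit (gaussMap y) : ℝ) ^ p) k x ∧
      birkhoffSum gaussMapSq (fun y => (gaussDigit y : ℝ)) k x ≤ n := by
  induction n with
  | zero => exact fun _ _ => ⟨0, by simp⟩
  | succ n ih =>
    intro x hx h
    have hhalf : x ≠ 1 / 2 := by simpa using hx.ne_rat (1 / 2)
    rcases lt_or_gt_of_ne hhalf with h2 | h2
    · obtain ⟨hd, hT⟩ := cfMap_neg_one_one_sub_of_lt_half h.1 h2
      obtain ⟨ha, hG⟩ := gaussDigit_gaussMap_of_lt_half h.1 h2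
      obtain ⟨hy, hy'⟩ := irrational_div_one_sub hx h.1 h2
      obtain ⟨k, hk1, hk2⟩ := ih hy hy'
      refine ⟨k, ?_⟩
      rw [Finset.sum_range_succ']
      simp only [negDigit_succ_of_cfMap_eq hT, zero_add, hd, Int.cast_ofNat, sub_self, add_zero]
      -- The new digit `2` adds nothing to the excess. It lengthens the first complete block by one,
      -- or, if `k = 0`, only the incomplete block.
      cases k with
      | zero => simp at hk1 ⊢; exact ⟨hk1, by positivity⟩
      | succ k =>
        rw [birkhoffSum_succ'] at hk1 hk2 ⊢
        rw [birkhoffSum_succ', ha]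
        simp only [gaussMapSq, hG] at hk1 hk2 ⊢
        push_cast
        exact ⟨hk1, by linarith⟩
    · obtain ⟨ha, hd, hT⟩ := cfMap_neg_one_one_sub_of_half_lt hx h2 h.2
      obtain ⟨hy, hy'⟩ := hx.gaussMap_mem_Ioo.1.gaussMap_mem_Ioo
      obtain ⟨k, hk1, hk2⟩ := ih hy hy'
      refine ⟨k + 1, ?_⟩
      rw [Finset.sum_range_succ', birkhoffSum_succ', birkhoffSum_succ', ha, zero_add, hd]
      simp only [negDigit_succ_of_cfMap_eq hT]
      have hsub := Real.rpow_add_le_add_rpow (Nat.cast_nonneg (gaussDigit (gaussMap x)))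
        (zero_le_two (α := ℝ)) hp0.le hp1.le
      push_cast
      simp only [gaussMapSq] at hk1 hk2 ⊢
      constructor <;> linarith

/-! ### Convergence of the power means. -/

lemma tendsto_negDigitPowerMean {p : ℝ} (hp0 : 0 < p) (hp1 : p < 1) {x : ℝ} (hx : Irrational x)
    (h : x ∈ Set.Ioo (0 : ℝ) 1)
    (hsum : ∀ m : ℕ, ∀ᶠ k : ℕ in atTop,
      birkhoffSum gaussMapSq (fun y => (gaussDigit (gaussMap y) : ℝ) ^ p) k x ≤
        1 / ((m : ℝ) + 1) * birkhoffSum gaussMapSq (fun y => (gaussDigit y : ℝ)) k x) :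
    Tendsto (fun n : ℕ => negDigitPowerMean p n x) atTop (𝓝 2) := by
  have hmono : Monotone fun k =>
      birkhoffSum gaussMapSq (fun y => (gaussDigit (gaussMap y) : ℝ) ^ p) k x :=
    monotone_nat_of_le_succ fun k => by
      rw [birkhoffSum_succ]; exact le_add_of_nonneg_right (by positivity)
  have hmean : Tendsto (fun n : ℕ => (∑ k ∈ Finset.Icc 1 n, (negDigit x k : ℝ) ^ p) / (n : ℝ))
      atTop (𝓝 (2 ^ p)) := by
    have hS : ∀ n : ℕ, ∑ k ∈ Finset.Icc 1 n, (negDigit x k : ℝ) ^ p =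
        ∑ i ∈ Finset.range n, ((negDigit x (i + 1) : ℝ) ^ p - 2 ^ p) + n * 2 ^ p := by
      intro n
      rw [Finset.sum_sub_distrib, Finset.sum_const, Finset.card_range, nsmul_eq_mul, sub_add_cancel,
        Finset.range_eq_Ico, Finset.sum_Ico_add' (fun k => (negDigit x k : ℝ) ^ p) 0 n 1]
      rfl
    refine tendsto_order.2 ⟨fun a ha => ?_, fun b hb => ?_⟩
    · filter_upwards [eventually_gt_atTop 0] with n hn
      have hn' : (0 : ℝ) < n := by exact_mod_cast hn
      rw [lt_div_iff₀ hn', hS]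
      have : 0 ≤ ∑ i ∈ Finset.range n, ((negDigit x (i + 1) : ℝ) ^ p - 2 ^ p) :=
        Finset.sum_nonneg fun i _ => sub_nonneg.2
          (Real.rpow_le_rpow zero_le_two (by exact_mod_cast two_le_negDigit i hx h) hp0.le)
      nlinarith
    · obtain ⟨m, hm⟩ := exists_nat_one_div_lt (half_pos (sub_pos.2 hb))
      obtain ⟨K, hK⟩ := eventually_atTop.1 (hsum m)
      set C := birkhoffSum gaussMapSq (fun y => (gaussDigit (gaussMap y) : ℝ) ^ p) K x
      have hC := (tendsto_const_div_atTop_nhds_zero_nat C).eventually_lt_const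
        (half_pos (sub_pos.2 hb))
      filter_upwards [eventually_gt_atTop 0, hC] with n hn hCn
      have hn' : (0 : ℝ) < n := by exact_mod_cast hn
      rw [div_lt_iff₀ hn'] at hCn ⊢
      rw [hS]
      obtain ⟨k, hk1, hk2⟩ := exists_sum_negDigit_rpow_le hp0 hp1 n hx h
      have hlt : ∑ i ∈ Finset.range n, ((negDigit x (i + 1) : ℝ) ^ p - 2 ^ p)
          < (b - 2 ^ p) / 2 * n := by
        -- The number `k` of complete blocks need not be large: if `k ≤ K`, the excess is at most
        -- the constant `C`, which is `o(n)`.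
        rcases le_total k K with hkK | hkK
        · exact (hk1.trans (hmono hkK)).trans_lt hCn
        · calc _ ≤ _ := hk1.trans (hK k hkK)
            _ ≤ 1 / ((m : ℝ) + 1) * n := mul_le_mul_of_nonneg_left hk2 (by positivity)
            _ < _ := mul_lt_mul_of_pos_right hm hn'
      have : 0 ≤ (b - 2 ^ p) / 2 * n := mul_nonneg (half_pos (sub_pos.2 hb)).le hn'.le
      linarith
  have := hmean.rpow_const (p := 1 / p) (Or.inr (by positivity))
  rwa [← Real.rpow_mul zero_le_two, mul_one_div_cancel hp0.ne', Real.rpow_one] at this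

theorem mainTheorem7 (p : ℝ) (hp0 : 0 < p) (hp1 : p < 1) :
    ∀ᵐ x ∂(volume.restrict (Set.Ico (0 : ℝ) 1)),
      Tendsto (fun n : ℕ => negDigitPowerMean p n x) atTop (𝓝 2) := by
  have hsum : ∀ᵐ x ∂(volume.restrict (Set.Ico (0 : ℝ) 1)), ∀ m : ℕ, ∀ᶠ k : ℕ in atTop,
      birkhoffSum gaussMapSq (fun y => (gaussDigit (gaussMap y) : ℝ) ^ p) k x ≤
        1 / ((m : ℝ) + 1) * birkhoffSum gaussMapSq (fun y => (gaussDigit y : ℝ)) k x :=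
    ae_all_iff.2 fun m => absolutelyContinuous_gaussMeasure.ae_le
      (ae_eventually_sum_rpow_le hp0 hp1 Nat.one_div_pos_of_nat)
  have hirr : ∀ᵐ x ∂(volume.restrict (Set.Ico (0 : ℝ) 1)), Irrational x :=
    ae_restrict_of_ae ((Set.countable_range ((↑) : ℚ → ℝ)).ae_notMem _)
  filter_upwards [hsum, hirr, ae_restrict_mem measurableSet_Ico] with x h1 h2 h3
  exact tendsto_negDigitPowerMean hp0 hp1 h2 ⟨lt_of_le_of_ne h3.1 h2.ne_zero.symm, h3.2⟩ h1
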